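/- For a positive integer $k$ let $\operatorname{supp}(k)$ be the set of positions of the $1$s in the binary expansion of $k$, and let $s_2(k)=|\operatorname{supp}(k)|$ be its binary weight. There is a unique lexicographically earliest sequence $(a(n))_{n\ge 1}$ among all infinite sequences of distinct positive integers such that $\operatorname{supp}(a(n))\cap\operatorname{supp}(a(n-1))\neq\emptyset$ for all $n\ge 2$ and $\operatorname{supp}(a(n))\cap\operatorname{supp}(a(n-2))=\emptyset$ for all $n\ge 3$ (the Binary Enots Wolley sequence, A338833). Every positive integer $n$ with $s_2(n)\ge 2$ appears in this sequence. Moreover $a(1)=1$, and the remaining terms $a(2),a(3),\dots$ form a permutation of the positive integers that are not powers of $2$: each such integer occurs exactly once among them, and nothing else occurs. -/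

import Mathlib

/-- The support of `k`: the set of positions of the `1`s in the binary expansion of `k`
(position `i` carries the value `2 ^ i`). -/
def supp (k : ℕ) : Finset ℕ := k.bitIndices.toFinset

/-- The binary weight of `k`: the number of `1`s in its binary expansion. -/
def s₂ (k : ℕ) : ℕ := (supp k).card

/-- The infinite sequences of distinct positive integers in which every term shares a `1` with the
term before it, and shares no `1` with the term two places before it.  Sequences are indexed from
`0`, so `a 0, a 1, a 2, …` are the first, second, third, … terms; the two conditions are imposed
wherever the earlier term exists. -/
structure IsEnotsWolleyLike (a : ℕ → ℕ) : Prop where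
  pos : ∀ n, 0 < a n
  distinct : Function.Injective a
  meets_prev : ∀ n, (supp (a (n + 1)) ∩ supp (a n)).Nonempty
  disjoint_prev_prev : ∀ n, Disjoint (supp (a (n + 2))) (supp (a n))

/-- `a` is the Binary Enots Wolley sequence: the lexicographically earliest sequence with the
above properties. -/
def IsBinaryEnotsWolley (a : ℕ → ℕ) : Prop :=
  IsLeast {b : Lex (ℕ → ℕ) | IsEnotsWolleyLike (ofLex b)} (toLex a)

/-! An admissible sequence can be built greedily: a term not contained in its predecessor always has
a successor, and admissibility forces this non-containment, so the greedy sequence is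
lexicographically least.

Suppose a set `s` of at least two bits never occurs. Terms tend to infinity, so `s` is not a
candidate at late steps. Hence `s` either meets all late terms or avoids all late terms: a counting
argument (`eventually_disjoint_of_disjoint`) excludes mixed behaviour, and avoidance is impossible
(`not_eventually_disjoint`). So every missing `s` meets all late terms. Then a pair of bits far
beyond `s` is missing too and meets all late terms as well. But a large new bit `b` always enters in
a pair `{j, b}` (`eq_pair_of_new_bit`), and `j` alone cannot serve both sets.

A power of two meeting its predecessor would be contained in it, so only the first term is one. -/

/-! ### Numbers as finite sets of bits -/

theorem mem_supp {i k : ℕ} : i ∈ supp k ↔ k.testBit i := by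
  simp [supp]

theorem supp_sum_two_pow (s : Finset ℕ) : supp (∑ i ∈ s, 2 ^ i) = s :=
  Finset.toFinset_bitIndices_sum_two_pow s

theorem sum_two_pow_supp (k : ℕ) : ∑ i ∈ supp k, 2 ^ i = k :=
  Finset.sum_toFinset_bitIndices_two_pow k

theorem supp_injective : Function.Injective supp := fun a b h => by
  rw [← sum_two_pow_supp a, ← sum_two_pow_supp b, h]

theorem sum_two_pow_le_of_subset {s t : Finset ℕ} (h : s ⊆ t) :
    ∑ i ∈ s, 2 ^ i ≤ ∑ i ∈ t, 2 ^ i :=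
  Finset.sum_le_sum_of_subset h

theorem supp_two_pow (k : ℕ) : supp (2 ^ k) = {k} := by
  simpa using supp_sum_two_pow {k}

theorem supp_nonempty {k : ℕ} (h : 0 < k) : (supp k).Nonempty := by
  rw [Finset.nonempty_iff_ne_empty]
  intro h0
  have := sum_two_pow_supp k
  rw [h0] at this
  simp at this
  omega

theorem sum_pair_two_pow {i j : ℕ} (h : i ≠ j) :
    ∑ l ∈ ({i, j} : Finset ℕ), 2 ^ l = 2 ^ i + 2 ^ j := Finset.sum_pair h

theorem two_pow_le_of_mem_supp {i k : ℕ} (h : i ∈ supp k) : 2 ^ i ≤ k :=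
  Nat.ge_two_pow_of_testBit (mem_supp.1 h)

/-- A sequence that satisfies the support conditions and whose terms from the third on are
bounded by every admissible unused candidate. -/
structure IsGreedy (a : ℕ → ℕ) : Prop extends IsEnotsWolleyLike a where
  le_candidate : ∀ (k : ℕ) (s : Finset ℕ), Disjoint s (supp (a k)) →
    ¬ Disjoint s (supp (a (k + 1))) → ¬ s ⊆ supp (a (k + 1)) →
    (∀ i < k + 2, supp (a i) ≠ s) → a (k + 2) ≤ ∑ i ∈ s, 2 ^ i

/-! ### Consequences of the support conditions -/

namespace IsEnotsWolleyLike

variable {a : ℕ → ℕ}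

/-- The next term meets this one but avoids the one before, so a common bit is as required. -/
theorem exists_mem_not_mem (ha : IsEnotsWolleyLike a) (k : ℕ) :
    ∃ i ∈ supp (a (k + 1)), i ∉ supp (a k) := by
  obtain ⟨i, hi⟩ := ha.meets_prev (k + 1)
  rw [Finset.mem_inter] at hi
  exact ⟨i, hi.2, Finset.disjoint_left.1 (ha.disjoint_prev_prev k) hi.1⟩

theorem not_subset (ha : IsEnotsWolleyLike a) (k : ℕ) :
    ¬ supp (a (k + 1)) ⊆ supp (a k) := by
  obtain ⟨i, hi, hi'⟩ := ha.exists_mem_not_mem k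
  exact fun h => hi' (h hi)

theorem eventually_gt (ha : IsEnotsWolleyLike a) (M : ℕ) : ∃ K, ∀ k, K ≤ k → M < a k := by
  have := (ha.distinct.nat_tendsto_atTop).eventually (Filter.eventually_gt_atTop M)
  exact Filter.eventually_atTop.1 this

/-- Some late term has a bit above all bits of the first `N` terms; the first occurrence of that bit
is at index `N` or later. -/
theorem exists_new_bit (ha : IsEnotsWolleyLike a) (N : ℕ) :
    ∃ k b, N ≤ k ∧ N ≤ b ∧ b ∈ supp (a k) ∧ ∀ i < k, b ∉ supp (a i) := by
  obtain ⟨B, hB⟩ : ∃ B, ∀ i < N, a i < 2 ^ B := by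
    refine ⟨∑ i ∈ Finset.range N, a i, fun i hi => ?_⟩
    exact lt_of_le_of_lt (Finset.single_le_sum (f := a) (fun _ _ => Nat.zero_le _)
      (Finset.mem_range.2 hi)) Nat.lt_two_pow_self
  obtain ⟨K, hK⟩ := ha.eventually_gt (2 ^ (B + N))
  obtain ⟨b, hb, hbit⟩ := Nat.exists_ge_and_testBit_of_ge_two_pow (hK K le_rfl).le
  have hex : ∃ t, b ∈ supp (a t) := ⟨K, mem_supp.2 hbit⟩
  classical
  refine ⟨Nat.find hex, b, ?_, by omega, Nat.find_spec hex, fun i hi => Nat.find_min hex hi⟩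
  by_contra hlt
  have h1 := two_pow_le_of_mem_supp (Nat.find_spec hex)
  have h2 := hB _ (not_le.1 hlt)
  have h3 : 2 ^ B ≤ 2 ^ b := Nat.pow_le_pow_right (by norm_num) (by omega)
  omega

end IsEnotsWolleyLike

/-! ### Missing sets in a greedy sequence -/

namespace IsGreedy

variable {a : ℕ → ℕ}

/-- With `j` the least bit of the last term outside the one before it, `{j, b}` is unused because
`b` is new, which bounds the term above. The term contains `b` and some such bit `l ≥ j`, which
bounds it below by the same value. -/
theorem eq_pair_of_new_bit (ha : IsGreedy a) {k b : ℕ} (hb : b ∈ supp (a (k + 2)))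
    (hnew : ∀ i < k + 2, b ∉ supp (a i)) :
    ∃ j ∈ supp (a (k + 1)), j ∉ supp (a k) ∧ supp (a (k + 2)) = {j, b} := by
  have hne : (supp (a (k + 1)) \ supp (a k)).Nonempty := by
    obtain ⟨i, hi, hi'⟩ := ha.exists_mem_not_mem k
    exact ⟨i, Finset.mem_sdiff.2 ⟨hi, hi'⟩⟩
  set j := (supp (a (k + 1)) \ supp (a k)).min' hne with hj
  have hjm := Finset.min'_mem _ hne
  rw [← hj, Finset.mem_sdiff] at hjm
  have hjb : j ≠ b := fun h => hnew (k + 1) (by omega) (h ▸ hjm.1)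
  refine ⟨j, hjm.1, hjm.2, ?_⟩
  have hle : a (k + 2) ≤ 2 ^ j + 2 ^ b := by
    rw [← sum_pair_two_pow hjb]
    refine ha.le_candidate k _ ?_ ?_ ?_ ?_
    · simp [hjm.2, hnew k (by omega)]
    · simp [hjm.1]
    · simp [Finset.insert_subset_iff, hnew (k + 1) (by omega)]
    · intro i hi h
      exact hnew i hi (by simp [h])
  obtain ⟨l, hl⟩ := ha.meets_prev (k + 1)
  rw [Finset.mem_inter] at hl
  have hlk := Finset.disjoint_left.1 (ha.disjoint_prev_prev k) hl.1
  have hjl : j ≤ l := Finset.min'_le _ _ (Finset.mem_sdiff.2 ⟨hl.2, hlk⟩)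
  have hlb : l ≠ b := fun h => hnew (k + 1) (by omega) (h ▸ hl.2)
  have hge : 2 ^ l + 2 ^ b ≤ a (k + 2) := by
    rw [← sum_pair_two_pow hlb, ← sum_two_pow_supp (a (k + 2))]
    apply sum_two_pow_le_of_subset
    simp [Finset.insert_subset_iff, hl.1, hb]
  have hpow : 2 ^ j ≤ 2 ^ l := Nat.pow_le_pow_right (by norm_num) hjl
  have heq : a (k + 2) = ∑ i ∈ ({j, b} : Finset ℕ), 2 ^ i := by
    rw [sum_pair_two_pow hjb]; omega
  rw [heq, supp_sum_two_pow]

/-- A set that never occurs is eventually never an admissible candidate. -/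
theorem eventually_subset_of_disjoint (ha : IsGreedy a) {s : Finset ℕ}
    (hs : ∀ i, supp (a i) ≠ s) :
    ∃ K, ∀ k, K ≤ k → Disjoint s (supp (a k)) →
      Disjoint s (supp (a (k + 1))) ∨ s ⊆ supp (a (k + 1)) := by
  obtain ⟨K, hK⟩ := ha.eventually_gt (∑ i ∈ s, 2 ^ i)
  refine ⟨K, fun k hk hd => ?_⟩
  by_contra! h
  have := ha.le_candidate k s hd h.1 h.2 fun i _ => hs i
  have := hK (k + 2) (by omega)
  omega

/-- If a missing set with two elements is disjoint from a late term, then it is disjoint from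
all later terms up to finitely many. -/
theorem eventually_disjoint_of_disjoint (ha : IsGreedy a) {s : Finset ℕ} {x y : ℕ}
    (hx : x ∈ s) (hy : y ∈ s) (hxy : x ≠ y) {K t₀ : ℕ}
    (hK : ∀ k, K ≤ k → Disjoint s (supp (a k)) →
      Disjoint s (supp (a (k + 1))) ∨ s ⊆ supp (a (k + 1)))
    (ht₀ : K ≤ t₀) (hd : Disjoint s (supp (a t₀))) :
    ∃ T, ∀ t, T ≤ t → Disjoint s (supp (a t)) := by
  set E : ℕ → Prop := fun t => Disjoint s (supp (a t)) with hE
  set F : ℕ → Prop := fun t => s ⊆ supp (a t) with hF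
  have hEF : ∀ t, E t → F t → False := fun t h h' => Finset.disjoint_left.1 h hx (h' hx)
  have hFE : ∀ t, F t → E (t + 2) := fun t h =>
    (Finset.disjoint_of_subset_right h (ha.disjoint_prev_prev t)).symm
  -- A partial intersection occurs only right after a full one.
  have hP : ∀ t, t₀ ≤ t → ¬ E (t + 1) → ¬ F (t + 1) → F t := by
    intro t ht
    induction t, ht using Nat.le_induction with
    | base =>
      intro h1 h2
      rcases hK t₀ ht₀ hd with h | h
      exacts [absurd h h1, absurd h h2]
    | succ t ht ih =>
      intro h1 h2
      by_contra h3
      by_cases h4 : E (t + 1)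
      · rcases hK (t + 1) (by omega) h4 with h | h
        exacts [h1 h, h2 h]
      · exact h1 (hFE t (ih h4 h3))
  -- If term `t` were full, term `t + 2` would be disjoint from `s`; if partial, term `t - 1` would
  -- be full by `hP`, making term `t + 1` disjoint.
  have hF2 : ∀ t, t₀ ≤ t → ¬ E (t + 2) → F (t + 1) → E t := by
    intro t ht h2 h1
    by_contra h0
    by_cases hf : F t
    · exact h2 (hFE t hf)
    · rcases Nat.eq_or_lt_of_le ht with rfl | hlt
      · exact h0 hd
      · obtain ⟨u, rfl⟩ : ∃ u, t = u + 1 := ⟨t - 1, by omega⟩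
        exact hEF _ (hFE u (hP u (by omega) h0 hf)) h1
  -- `S u` says that a block of terms meeting `s` starts, with a full term, at index `u + 2`.
  set S : ℕ → Prop := fun u => E (u + 1) ∧ F (u + 2) with hS
  have hstart : ∀ u, t₀ ≤ u → ¬ E (u + 3) → ¬ F (u + 3) → S u := fun u hu h3 h3' =>
    have h2 : F (u + 2) := hP (u + 2) (by omega) h3 h3'
    ⟨hF2 (u + 1) (by omega) h3 h2, h2⟩
  classical
  -- Removing an element of `s` from the first term of a block gives an earlier term.
  have hrem : ∀ z ∈ s, ∀ u, t₀ ≤ u → S u → ∃ i < u + 2,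
      supp (a i) = (supp (a (u + 2))).erase z ∧ (i < t₀ + 3 ∨ ∃ v, t₀ ≤ v ∧ S v ∧ i = v + 3) := by
    rintro z hz u hu ⟨he, hf⟩
    obtain ⟨w, hw, hwz⟩ : ∃ w ∈ s, w ≠ z := by
      by_cases h : x = z
      · exact ⟨y, hy, fun h' => hxy (h.trans h'.symm)⟩
      · exact ⟨x, hx, h⟩
    -- The smaller set still meets term `u + 1`, because the common bit lies outside `s`, and `w`
    -- keeps it from being contained there. Were it unused, greed would prefer it.
    have hused : ∃ i < u + 2, supp (a i) = (supp (a (u + 2))).erase z := by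
      by_contra! hno
      have hle := ha.le_candidate u ((supp (a (u + 2))).erase z)
        (Finset.disjoint_of_subset_left (Finset.erase_subset _ _) (ha.disjoint_prev_prev u))
        (by
          obtain ⟨l, hl⟩ := ha.meets_prev (u + 1)
          rw [Finset.mem_inter] at hl
          refine Finset.not_disjoint_iff.2 ⟨l, Finset.mem_erase.2 ⟨?_, hl.1⟩, hl.2⟩
          rintro rfl
          exact Finset.disjoint_left.1 he hz hl.2)
        (fun h => Finset.disjoint_left.1 he hw (h (Finset.mem_erase.2 ⟨hwz, hf hw⟩)))
        hno
      have hsum := Finset.add_sum_erase (supp (a (u + 2))) (fun i => 2 ^ i) (hf hz)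
      rw [sum_two_pow_supp] at hsum
      have : 0 < 2 ^ z := by positivity
      omega
    obtain ⟨i, hi, hia⟩ := hused
    refine ⟨i, hi, hia, ?_⟩
    by_contra! hcon
    obtain ⟨v, rfl⟩ : ∃ v, i = v + 3 := ⟨i - 3, by omega⟩
    refine hcon.2 v (by omega) (hstart v (by omega) ?_ ?_) rfl
    · intro h
      exact Finset.disjoint_left.1 h hw (hia ▸ Finset.mem_erase.2 ⟨hwz, hf hw⟩)
    · intro h
      have := h hz
      rw [hia] at this
      exact Finset.notMem_erase _ _ this
  -- Each block yields two distinct earlier partial terms, by removing `x` or `y`, but apart from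
  -- indices below `t₀ + 3` each block contains at most one partial term. So `2 |R| ≤ t₀ + 3 + |R|`.
  have hfin : {u | t₀ ≤ u ∧ S u}.Finite := by
    by_contra hinf
    obtain ⟨Q, hQ, hQc⟩ := (Set.not_finite.1 hinf).exists_subset_card_eq (t₀ + 4)
    -- All block starts up to a bound are taken, so that the earlier blocks produced by `hrem` are
    -- again in `R`.
    set R := (Finset.Ico t₀ (Q.sup id + 1)).filter S with hR
    have hQR : Q ⊆ R := fun q hq => by
      have h1 := hQ hq
      have h2 : q ≤ Q.sup id := Finset.le_sup (f := id) hq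
      simp only [hR, Finset.mem_filter, Finset.mem_Ico]
      exact ⟨⟨h1.1, by omega⟩, h1.2⟩
    have hcard : (R ×ˢ ({x, y} : Finset ℕ)).card ≤
        (Finset.range (t₀ + 3) ∪ R.image (· + 3)).card := by
      have hch : ∀ p ∈ R ×ˢ ({x, y} : Finset ℕ), ∃ i < p.1 + 2,
          supp (a i) = (supp (a (p.1 + 2))).erase p.2 ∧
          (i < t₀ + 3 ∨ ∃ v, t₀ ≤ v ∧ S v ∧ i = v + 3) := by
        intro p hp
        simp only [hR, Finset.mem_product, Finset.mem_filter, Finset.mem_Ico,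
          Finset.mem_insert, Finset.mem_singleton] at hp
        refine hrem p.2 ?_ p.1 hp.1.1.1 hp.1.2
        rcases hp.2 with h | h <;> rw [h] <;> assumption
      choose! g hg1 hg2 hg3 using hch
      have hsub : ∀ p ∈ R ×ˢ ({x, y} : Finset ℕ), p.2 ∈ s ∧ s ⊆ supp (a (p.1 + 2)) := by
        intro p hp
        simp only [hR, Finset.mem_product, Finset.mem_filter, Finset.mem_insert,
          Finset.mem_singleton] at hp
        refine ⟨?_, hp.1.2.2⟩
        rcases hp.2 with h | h <;> rw [h] <;> assumption
      refine Finset.card_le_card_of_injOn g ?_ ?_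
      · intro p hp
        have hp' := hp
        simp only [hR, Finset.coe_product, Set.mem_prod, Finset.mem_coe, Finset.mem_filter,
          Finset.mem_Ico] at hp'
        have h1 := hg1 p hp
        rcases hg3 p hp with h | ⟨v, hv, hSv, h⟩
        · simp [h]
        · refine Finset.mem_coe.2 (Finset.mem_union_right _ (Finset.mem_image.2 ⟨v, ?_, h.symm⟩))
          simp only [hR, Finset.mem_filter, Finset.mem_Ico]
          exact ⟨⟨hv, by omega⟩, hSv⟩
      · intro p hp q hq hpq
        have h1 := hg2 p hp
        rw [hpq, hg2 q hq] at h1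
        obtain ⟨hp1, hp2⟩ := hsub p hp
        obtain ⟨hq1, hq2⟩ := hsub q hq
        have h2 : p.2 = q.2 := by
          by_contra hne
          have : p.2 ∈ (supp (a (q.1 + 2))).erase q.2 := Finset.mem_erase.2 ⟨hne, hq2 hp1⟩
          rw [h1] at this
          exact Finset.notMem_erase _ _ this
        have h3 : supp (a (p.1 + 2)) = supp (a (q.1 + 2)) := by
          rw [← Finset.insert_erase (hp2 hp1), ← h1, h2, Finset.insert_erase (hq2 hq1)]
        have h4 := ha.distinct (supp_injective h3)
        exact Prod.ext (by omega) h2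
    rw [Finset.card_product, Finset.card_pair hxy] at hcard
    have h1 := Finset.card_union_le (Finset.range (t₀ + 3)) (R.image (· + 3))
    have h2 : (R.image (· + 3)).card ≤ R.card := Finset.card_image_le
    have h3 := Finset.card_le_card hQR
    rw [Finset.card_range] at h1
    omega
  obtain ⟨B, hB⟩ := hfin.bddAbove
  refine ⟨B + t₀ + 4, fun t ht => ?_⟩
  obtain ⟨u, rfl⟩ : ∃ u, t = u + 3 := ⟨t - 3, by omega⟩
  by_contra h3
  have hSu : ¬ S u := fun h => absurd (hB ⟨by omega, h⟩) (by omega)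
  have hSu1 : ¬ S (u + 1) := fun h => absurd (hB ⟨by omega, h⟩) (by omega)
  by_cases hf : F (u + 3)
  · by_cases h2 : E (u + 2)
    · exact hSu1 ⟨h2, hf⟩
    · by_cases hf2 : F (u + 2)
      · exact hSu ⟨hF2 (u + 1) (by omega) h3 hf2, hf2⟩
      · exact h3 (hFE (u + 1) (hP (u + 1) (by omega) h2 hf2))
  · exact hSu (hstart u (by omega) h3 hf)

/-- No nonempty set of bits avoids all late terms. -/
theorem not_eventually_disjoint (ha : IsGreedy a) {s : Finset ℕ} (hs : s.Nonempty) {T : ℕ}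
    (hT : ∀ t, T ≤ t → Disjoint s (supp (a t))) : False := by
  obtain ⟨x, hx⟩ := hs
  have hxT : ∀ t, T ≤ t → x ∉ supp (a t) := fun t ht => Finset.disjoint_left.1 (hT t ht) hx
  obtain ⟨C, hC⟩ : ∃ C, ∀ i < T, ∀ c ∈ supp (a i), c < C := by
    refine ⟨∑ i ∈ Finset.range T, a i, fun i hi c hc => ?_⟩
    exact (Nat.lt_two_pow_self.trans_le (two_pow_le_of_mem_supp hc)).trans_le
      (Finset.single_le_sum (f := a) (fun _ _ => Nat.zero_le _) (Finset.mem_range.2 hi))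
  -- This leaves two values strictly between `C + x` and `D`, so one of them differs from `j`.
  set D := C + x + 3 with hD
  obtain ⟨K, hK⟩ := ha.eventually_gt (2 ^ D)
  obtain ⟨n, b, hn, hbn, hb, hnew⟩ := ha.exists_new_bit (T + K + D + 2)
  obtain ⟨k, rfl⟩ : ∃ k, n = k + 2 := ⟨n - 2, by omega⟩
  obtain ⟨j, hj, hj', hpair⟩ := ha.eq_pair_of_new_bit hb hnew
  have hbx : b ≠ x := by omega
  -- The term after `{j, b}` is below `2 ^ b + 2 ^ x` and contains `b`.
  have hle : a (k + 3) ≤ 2 ^ b + 2 ^ x := by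
    rw [← sum_pair_two_pow hbx]
    refine ha.le_candidate (k + 1) _ ?_ ?_ ?_ ?_
    · simp [hnew (k + 1) (by omega), hxT (k + 1) (by omega)]
    · simp [hb]
    · simp [Finset.insert_subset_iff, hxT (k + 2) (by omega)]
    · intro i hi h
      rcases Nat.lt_or_ge i (k + 2) with h' | h'
      · exact hnew i h' (by simp [h])
      · exact hxT i (by omega) (by simp [h])
  have hjn : j ∉ supp (a (k + 3)) := fun h =>
    Finset.disjoint_left.1 (ha.disjoint_prev_prev (k + 1)) h hj
  have hb3 : b ∈ supp (a (k + 3)) := by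
    obtain ⟨l, hl⟩ := ha.meets_prev (k + 2)
    rw [Finset.mem_inter, hpair, Finset.mem_insert, Finset.mem_singleton] at hl
    rcases hl.2 with rfl | rfl
    exacts [absurd hl.1 hjn, hl.1]
  obtain ⟨m, hm, hm'⟩ := ha.exists_mem_not_mem (k + 2)
  have hmb : m ≠ b := fun h => hm' (h ▸ hb)
  have hmx : m < x := by
    have h1 : 2 ^ m + 2 ^ b ≤ a (k + 3) := by
      rw [← sum_pair_two_pow hmb, ← sum_two_pow_supp (a (k + 3))]
      apply sum_two_pow_le_of_subset
      simp [Finset.insert_subset_iff, hm, hb3]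
    have h2 : m ≤ x := (Nat.pow_le_pow_iff_right (by norm_num : 1 < 2)).1 (by omega)
    exact lt_of_le_of_ne h2 fun h => hxT (k + 3) (by omega) (h ▸ hm)
  obtain ⟨c, hc, hcD, hcj⟩ : ∃ c, C + x < c ∧ c < D ∧ c ≠ j := by
    by_cases h : C + x + 1 = j
    · exact ⟨C + x + 2, by omega, by omega, by omega⟩
    · exact ⟨C + x + 1, by omega, by omega, h⟩
  have hxj : x ≠ j := fun h => hxT (k + 1) (by omega) (h ▸ hj)
  have hmj : m ≠ j := fun h => hjn (h ▸ hm)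
  -- This set is unused: `c` exceeds every bit of the terms before `T`, and `x` is absent from then
  -- on. Its value is below `2 ^ D`, too small for a late term.
  have hcand := ha.le_candidate (k + 2) {m, x, c}
    (by
      rw [hpair]
      simp only [Finset.disjoint_left, Finset.mem_insert, Finset.mem_singleton]
      omega)
    (by simp [hm])
    (by simp [Finset.insert_subset_iff, hxT (k + 3) (by omega)])
    (by
      intro i _ h
      rcases Nat.lt_or_ge i T with h' | h'
      · have := hC i h' c (by simp [h])
        omega
      · exact hxT i h' (by simp [h]))
  have hsum : ∑ i ∈ ({m, x, c} : Finset ℕ), 2 ^ i < 2 ^ D := by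
    apply Nat.geomSum_lt (by norm_num)
    simp only [Finset.mem_insert, Finset.mem_singleton]
    omega
  have := hK (k + 2 + 2) (by omega)
  omega

/-- Every set with at least two elements occurs as the support of a term. -/
theorem exists_supp_eq (ha : IsGreedy a) {s : Finset ℕ} (hs : 1 < s.card) :
    ∃ i, supp (a i) = s := by
  have key : ∀ s : Finset ℕ, 1 < s.card → (∀ i, supp (a i) ≠ s) →
      ∃ K, ∀ t, K ≤ t → ¬ Disjoint s (supp (a t)) := by
    intro s hs hmiss
    obtain ⟨x, hx, y, hy, hxy⟩ := Finset.one_lt_card.1 hs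
    obtain ⟨K, hK⟩ := ha.eventually_subset_of_disjoint hmiss
    refine ⟨K, fun t ht hd => ?_⟩
    obtain ⟨T, hT⟩ := ha.eventually_disjoint_of_disjoint hx hy hxy hK ht hd
    exact ha.not_eventually_disjoint ⟨x, hx⟩ hT
  by_contra! hmiss
  obtain ⟨K, hK⟩ := key s hs hmiss
  -- A pair of bits beyond `s` and beyond the terms before `K` is missing too.
  set c := s.sup id + ∑ i ∈ Finset.range K, a i + 1 with hc
  have hsc : ∀ i ∈ s, i < c := fun i hi => by
    have : i ≤ s.sup id := Finset.le_sup (f := id) hi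
    omega
  have hmiss' : ∀ i, supp (a i) ≠ {c, c + 1} := by
    intro i h
    rcases Nat.lt_or_ge i K with hi | hi
    · have h1 : 2 ^ c ≤ a i := two_pow_le_of_mem_supp (by simp [h])
      have h2 := Finset.single_le_sum (f := a) (fun _ _ => Nat.zero_le _) (Finset.mem_range.2 hi)
      have h3 : c < 2 ^ c := Nat.lt_two_pow_self
      omega
    · refine hK i hi ?_
      rw [h, Finset.disjoint_left]
      intro l hl
      have := hsc l hl
      simp only [Finset.mem_insert, Finset.mem_singleton]
      omega
  obtain ⟨K', hK'⟩ := key {c, c + 1} (by rw [Finset.card_pair (by omega)]; norm_num) hmiss'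
  obtain ⟨n, b, hn, hbn, hb, hnew⟩ := ha.exists_new_bit (K + K' + c + 4)
  obtain ⟨k, rfl⟩ : ∃ k, n = k + 2 := ⟨n - 2, by omega⟩
  obtain ⟨j, -, -, hpair⟩ := ha.eq_pair_of_new_bit hb hnew
  refine hK' (k + 2) (by omega) ?_
  -- The late pair `{j, b}` meets `s`, and `b` is too large to lie in it.
  have hjs : j ∈ s := by
    obtain ⟨l, hl, hl'⟩ := Finset.not_disjoint_iff.1 (hK (k + 2) (by omega))
    rw [hpair, Finset.mem_insert, Finset.mem_singleton] at hl'
    rcases hl' with rfl | rfl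
    · exact hl
    · have := hsc _ hl
      omega
  have := hsc j hjs
  rw [hpair]
  simp only [Finset.disjoint_left, Finset.mem_insert, Finset.mem_singleton]
  omega

end IsGreedy

/-! ### Construction and minimality of the greedy sequence -/

/-- The sequence in which every term is the least unused positive integer that satisfies the
support conditions and is not contained in its predecessor. -/
noncomputable def greedy (n : ℕ) : ℕ :=
  sInf {c | 0 < c ∧ (∀ i, (_ : i < n) → greedy i ≠ c) ∧
    (∀ m, (_ : n = m + 1) → ¬ Disjoint (supp c) (supp (greedy m)) ∧
      ¬ supp c ⊆ supp (greedy m)) ∧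
    ∀ m, (_ : n = m + 2) → Disjoint (supp c) (supp (greedy m))}
termination_by n
decreasing_by all_goals omega

/-- `c` may follow the terms `a 0, …, a (n - 1)`. -/
structure IsCandidate (a : ℕ → ℕ) (n c : ℕ) : Prop where
  pos : 0 < c
  unused : ∀ i < n, a i ≠ c
  meets : ∀ m, n = m + 1 → ¬ Disjoint (supp c) (supp (a m))
  not_subset : ∀ m, n = m + 1 → ¬ supp c ⊆ supp (a m)
  disjoint : ∀ m, n = m + 2 → Disjoint (supp c) (supp (a m))

theorem greedy_eq_sInf (n : ℕ) : greedy n = sInf {c | IsCandidate greedy n c} := by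
  rw [greedy]
  congr 1
  ext c
  constructor
  · rintro ⟨h1, h2, h3, h4⟩
    exact ⟨h1, h2, fun m h => (h3 m h).1, fun m h => (h3 m h).2, h4⟩
  · rintro ⟨h1, h2, h3, h3', h4⟩
    exact ⟨h1, h2, fun m h => ⟨h3 m h, h3' m h⟩, h4⟩

theorem greedy_le {n c : ℕ} (h : IsCandidate greedy n c) : greedy n ≤ c := by
  rw [greedy_eq_sInf]
  exact Nat.sInf_le h

/-- A bit of the last term outside the one before it, paired with a bit larger than any used, is a
candidate. So the infimum defining `greedy` is attained and never the default `0`. -/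
theorem IsCandidate.exists {a : ℕ → ℕ} {n : ℕ} (h : ∀ i < n, IsCandidate a i (a i)) :
    ∃ c, IsCandidate a n c := by
  rcases n with _ | n
  · exact ⟨1, by norm_num, by omega, by omega, by omega, by omega⟩
  obtain ⟨j, hj, hj'⟩ : ∃ j ∈ supp (a n), ∀ m, n = m + 1 → j ∉ supp (a m) := by
    rcases n with _ | n
    · obtain ⟨j, hj⟩ := supp_nonempty (h 0 (by omega)).pos
      exact ⟨j, hj, by omega⟩
    · obtain ⟨j, hj, hj'⟩ := Finset.not_subset.1 ((h (n + 1) (by omega)).not_subset n rfl)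
      refine ⟨j, hj, fun m hm => ?_⟩
      obtain rfl : n = m := by omega
      exact hj'
  set b := ∑ i ∈ Finset.range (n + 1), a i with hb
  have hbn : ∀ i < n + 1, b ∉ supp (a i) := fun i hi hbi => by
    have h1 := two_pow_le_of_mem_supp hbi
    have h2 := Finset.single_le_sum (f := a) (fun _ _ => Nat.zero_le _) (Finset.mem_range.2 hi)
    have h3 : b < 2 ^ b := Nat.lt_two_pow_self
    omega
  refine ⟨∑ i ∈ ({j, b} : Finset ℕ), 2 ^ i, ?_, ?_, ?_, ?_, ?_⟩
  · exact Finset.sum_pos (fun _ _ => by positivity) ⟨j, by simp⟩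
  · intro i hi h'
    apply hbn i hi
    rw [h', supp_sum_two_pow]
    simp
  · intro m hm
    obtain rfl : n = m := by omega
    simp [supp_sum_two_pow, hj]
  · intro m hm
    obtain rfl : n = m := by omega
    simp [supp_sum_two_pow, Finset.insert_subset_iff, hbn n (by omega)]
  · intro m hm
    simp [supp_sum_two_pow, hj' m (by omega), hbn m (by omega)]

theorem isCandidate_greedy (n : ℕ) : IsCandidate greedy n (greedy n) := by
  induction n using Nat.strong_induction_on with
  | _ n ih =>
    rw [greedy_eq_sInf n]
    exact Nat.sInf_mem (s := {c | IsCandidate greedy n c}) (IsCandidate.exists ih)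

theorem isGreedy_greedy : IsGreedy greedy where
  pos n := (isCandidate_greedy n).pos
  distinct i j h := by
    rcases Nat.lt_trichotomy i j with hij | hij | hij
    · exact absurd h ((isCandidate_greedy j).unused i hij)
    · exact hij
    · exact absurd h.symm ((isCandidate_greedy i).unused j hij)
  meets_prev n := by
    rw [Finset.nonempty_iff_ne_empty, Ne, ← Finset.disjoint_iff_inter_eq_empty]
    exact (isCandidate_greedy (n + 1)).meets n rfl
  disjoint_prev_prev n := (isCandidate_greedy (n + 2)).disjoint n rfl
  le_candidate k s h1 h2 h3 h4 := by
    refine greedy_le ⟨?_, ?_, ?_, ?_, ?_⟩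
    · obtain ⟨l, hl, -⟩ := Finset.not_disjoint_iff.1 h2
      exact Finset.sum_pos (fun _ _ => by positivity) ⟨l, hl⟩
    · intro i hi h
      exact h4 i hi (by rw [h, supp_sum_two_pow])
    · intro m hm
      obtain rfl : k + 1 = m := by omega
      rwa [supp_sum_two_pow]
    · intro m hm
      obtain rfl : k + 1 = m := by omega
      rwa [supp_sum_two_pow]
    · intro m hm
      obtain rfl : k = m := by omega
      rwa [supp_sum_two_pow]

theorem greedy_zero : greedy 0 = 1 :=
  le_antisymm (greedy_le ⟨by norm_num, by omega, by omega, by omega, by omega⟩)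
    (isCandidate_greedy 0).pos

theorem IsEnotsWolleyLike.isCandidate {b : ℕ → ℕ} (hb : IsEnotsWolleyLike b) (n : ℕ) :
    IsCandidate b n (b n) where
  pos := hb.pos n
  unused i hi h := hi.ne (hb.distinct h)
  meets m hm := by
    subst hm
    rw [Finset.disjoint_iff_inter_eq_empty, ← Ne, ← Finset.nonempty_iff_ne_empty]
    exact hb.meets_prev m
  not_subset m hm := by
    subst hm
    exact hb.not_subset m
  disjoint m hm := by
    subst hm
    exact hb.disjoint_prev_prev m

/-- At the first difference, the rival's term is a candidate after the common prefix, so the greedy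
term is smaller. -/
theorem isBinaryEnotsWolley_greedy : IsBinaryEnotsWolley greedy := by
  refine ⟨isGreedy_greedy.toIsEnotsWolleyLike, fun b hb => ?_⟩
  change IsEnotsWolleyLike (ofLex b) at hb
  by_cases hne : ∃ n, greedy n ≠ ofLex b n
  · classical
    refine le_of_lt ⟨Nat.find hne, fun i hi => not_not.1 (Nat.find_min hne hi), ?_⟩
    refine lt_of_le_of_ne (greedy_le ?_) (Nat.find_spec hne)
    have heq : ∀ i < Nat.find hne, ofLex b i = greedy i := fun i hi =>
      (not_not.1 (Nat.find_min hne hi)).symm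
    have h := hb.isCandidate (Nat.find hne)
    exact ⟨h.pos, fun i hi => heq i hi ▸ h.unused i hi,
      fun m hm => heq m (by omega) ▸ h.meets m hm,
      fun m hm => heq m (by omega) ▸ h.not_subset m hm,
      fun m hm => heq m (by omega) ▸ h.disjoint m hm⟩
  · push Not at hne
    exact le_of_eq (funext hne)

theorem IsBinaryEnotsWolley.eq_greedy {a : ℕ → ℕ} (ha : IsBinaryEnotsWolley a) : a = greedy :=
  toLex.injective (ha.unique isBinaryEnotsWolley_greedy)

/-! ### The permutation statement -/

theorem two_le_card_supp {n : ℕ} (hn : 0 < n) (h : ¬ ∃ k : ℕ, n = 2 ^ k) :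
    1 < (supp n).card := by
  by_contra hcard
  have h1 : (supp n).card = 1 := le_antisymm (by omega) (supp_nonempty hn).card_pos
  obtain ⟨k, hk⟩ := Finset.card_eq_one.1 h1
  exact h ⟨k, by rw [← sum_two_pow_supp n, hk]; simp⟩

theorem IsGreedy.exists_eq {a : ℕ → ℕ} (ha : IsGreedy a) {n : ℕ} (hn : 1 < (supp n).card) :
    ∃ i, a i = n := by
  obtain ⟨i, hi⟩ := ha.exists_supp_eq hn
  exact ⟨i, supp_injective hi⟩

theorem theorem5 :
    (∃! a : ℕ → ℕ, IsBinaryEnotsWolley a) ∧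
    ∀ a : ℕ → ℕ, IsBinaryEnotsWolley a →
      (∀ n : ℕ, 0 < n → 2 ≤ s₂ n → ∃ i : ℕ, a i = n) ∧
      a 0 = 1 ∧
      Set.BijOn a {i : ℕ | 1 ≤ i} {n : ℕ | 0 < n ∧ ¬ ∃ k : ℕ, n = 2 ^ k} := by
  refine ⟨⟨greedy, isBinaryEnotsWolley_greedy, fun a ha => ha.eq_greedy⟩, ?_⟩
  intro a ha
  obtain rfl := ha.eq_greedy
  refine ⟨fun n _ hn => isGreedy_greedy.exists_eq hn, greedy_zero, ?_,
    isGreedy_greedy.distinct.injOn, ?_⟩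
  · rintro i (hi : 1 ≤ i)
    obtain ⟨m, rfl⟩ : ∃ m, i = m + 1 := ⟨i - 1, by omega⟩
    refine ⟨isGreedy_greedy.pos _, ?_⟩
    rintro ⟨k, hk⟩
    have h1 := isGreedy_greedy.meets_prev m
    have h2 := isGreedy_greedy.not_subset m
    rw [hk, supp_two_pow] at h1 h2
    obtain ⟨l, hl⟩ := h1
    rw [Finset.mem_inter, Finset.mem_singleton] at hl
    obtain ⟨rfl, hl⟩ := hl
    exact h2 (Finset.singleton_subset_iff.2 hl)
  · rintro n ⟨hn, hpow⟩
    obtain ⟨i, hi⟩ := isGreedy_greedy.exists_eq (two_le_card_supp hn hpow)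
    refine ⟨i, ?_, hi⟩
    rcases Nat.eq_zero_or_pos i with rfl | h
    -- Index `0` carries `1 = 2 ^ 0`, which is excluded.
    · exact absurd ⟨0, by rw [← hi, greedy_zero]; rfl⟩ hpow
    · exact h
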